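/- Let $m$ be the Lebesgue measure on the unit circle $\mathbb T$, normalized by $m(\mathbb T)=1$. For a finite positive measure $\rho$ on $\mathbb T$ put $$e_n(\rho)=\min_{q_0,\dots,q_{n-1}\in\mathbb C}\Bigl(\int_{\mathbb T}\bigl|q_0+q_1t+\dots+q_{n-1}t^{n-1}+t^n\bigr|^2\,d\rho(t)\Bigr)^{1/2}.$$ For a lower semicontinuous function $H\colon\mathbb T\to[0,+\infty]$ and $a\ge 0$ let $\lambda_H(a)=m\{H>a\}$, and let $\lambda_H^*(a)$ be the (normalized) length of the longest open arc contained in the open set $\{H>a\}$. Let $c>0$, $q<2$ and $\kappa<1$. There is a constant $K>0$, depending only on $c$, $q$ and $\kappa$, such that the following holds. Let $H\colon\mathbb T\to[0,+\infty]$ be lower semicontinuous with $\int_{\mathbb T}H\,dm=+\infty$ and $m\{H=+\infty\}\le\kappa$, let $d\rho=e^{-H}\,dm$ (with $e^{-\infty}=0$), and suppose that $$\lambda_H^*(a)\ge c\,\lambda_H(a)\ \text{ for all sufficiently large } a,\qquad \limsup_{a\to\infty}\frac{\lambda_H(a)}{\lambda_H(2a)}\le q .$$ Then there is $n_0$ (depending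 on $H$) such that for every $n\ge n_0$ and every solution $A$ of the equation $n\lambda_H(A)=A$, $$K^{-1}A\lambda_H(A)\le|\log e_n(\rho)|\le K\,A\lambda_H(A).$$ -/

import Mathlib

open MeasureTheory Filter Topology
open scoped ENNReal

noncomputable section

namespace SzegoRate

/-- The prediction error `e_n(ρ)`: the distance in `L²(ρ)` from `t ^ n` to the polynomials of degree
at most `n - 1`. The unit circle is identified with `ℝ / ℤ` by `x ↦ t = exp (2 π i x)`. -/
def predErr (ρ : Measure UnitAddCircle) (n : ℕ) : ℝ :=
  ⨅ q : Fin n → ℂ, √(∫ x : UnitAddCircle,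
    ‖(∑ j : Fin n, q j * (AddCircle.toCircle x : ℂ) ^ (j : ℕ))
        + (AddCircle.toCircle x : ℂ) ^ n‖ ^ 2 ∂ρ)

/-- The measure `e^{-H} dm`, where `m` is normalized Lebesgue measure on the circle
(`volume` on `UnitAddCircle` has total mass one) and `e^{-∞} = 0`. -/
def expMeasure (H : UnitAddCircle → ℝ≥0∞) : Measure UnitAddCircle :=
  volume.withDensity fun x => EReal.exp (-(H x : EReal))

/-- The distribution function `λ_H(a) = m {H > a}` (for `a ≥ 0`). -/
def distrib (H : UnitAddCircle → ℝ≥0∞) (a : ℝ) : ℝ :=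
  volume.real {x : UnitAddCircle | ENNReal.ofReal a < H x}

/-- `λ*_H(a)`, the normalized length of the longest open arc contained in `{H > a}`
(zero if there is none, one if `{H > a}` is the whole circle). -/
def longestArc (H : UnitAddCircle → ℝ≥0∞) (a : ℝ) : ℝ :=
  sSup {l : ℝ | 0 ≤ l ∧ l ≤ 1 ∧ ∃ α : ℝ, ∀ θ ∈ Set.Ioo α (α + l),
    ENNReal.ofReal a < H (θ : UnitAddCircle)}

end SzegoRate

end

/-!
Write `λ` for the distribution function of `H`. By the doubling condition with constant below `2`,
`A λ(A) → ∞`, and `∫_{H ≤ A} H` is `O(A λ(A))`.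

Lower bound for the prediction error: let `p` be monic of degree `n` with
`∫ ‖p‖² e^{-H} ≤ e^{-T}`. Off the set `{H > A}`, whose measure is `λ(A) = A / n`, one has
`∫ ‖p‖² ≤ e^A`, and a Poisson-kernel estimate at distance about `λ(A)` from the circle upgrades this
to `log ‖p‖ ≲ A` everywhere. In Jensen's inequality `0 ≤ ∫ log ‖p‖` the set `{H > A}` thus
contributes `O(A λ(A))`, while its complement contributes at most half of
`∫_{H ≤ A} H - T (1 - λ(A)) + 1`. Hence `T = O(A λ(A))`.

Upper bound: `{H > A}` contains an arc of half-length `h` comparable to `λ(A)`. There is a function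
`F` holomorphic on the disc of radius `1 + h / 2`, bounded by an absolute constant, with
`Re F(0) ≥ h / 2` and `Re F ≤ 0` on the circle off that arc. Let `B` be a small multiple of `n h`.
Truncating the Taylor series of `e^{B F}` at degree `n` changes it by at most `1` on the circle, so
it gives a polynomial that is at most `2` off the arc, at most `2 e^{A / 2}` on it, and at least
`e^{B h / 2}` at `0`. Reflecting its coefficients and normalizing makes it monic, so the prediction
error is `O(e^{-B h / 2})`, where `B h` is comparable to `n h²`, hence to `A λ(A)`.
-/

namespace SzegoRate

open Real Polynomial
open AddCircle (toCircle)
open scoped ComplexConjugate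

section Circle

theorem norm_toCircle (x : UnitAddCircle) : ‖(toCircle x : ℂ)‖ = 1 :=
  Circle.norm_coe _

theorem continuous_coe_toCircle : Continuous fun x : UnitAddCircle => (toCircle x : ℂ) :=
  continuous_subtype_val.comp AddCircle.continuous_toCircle

theorem injective_coe_toCircle : Function.Injective fun x : UnitAddCircle => (toCircle x : ℂ) :=
  Subtype.val_injective.comp (AddCircle.injective_toCircle one_ne_zero)

instance : Nontrivial UnitAddCircle :=
  have := (Set.Ico_infinite (lt_add_one (0 : ℝ))).to_subtype
  (AddCircle.equivIco 1 0).nontrivial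

instance : IsProbabilityMeasure (volume : Measure UnitAddCircle) :=
  ⟨by simp⟩

theorem integrable_of_continuous {f : UnitAddCircle → ℝ} (hf : Continuous f) : Integrable f :=
  hf.integrable_of_hasCompactSupport (HasCompactSupport.of_compactSpace _)

theorem circleMap_two_pi_mul (θ : ℝ) :
    circleMap 0 1 (2 * π * θ) = (toCircle (θ : UnitAddCircle) : ℂ) := by
  simp [AddCircle.toCircle_apply_mk, circleMap, Circle.coe_exp]

theorem integral_comp_toCircle (f : ℂ → ℝ) :
    ∫ x : UnitAddCircle, f (toCircle x) = circleAverage f 0 1 := by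
  have rescale := intervalIntegral.integral_comp_mul_left (a := 0) (b := 1)
    (fun θ => f (circleMap 0 1 θ)) (c := 2 * π) (by positivity)
  rw [mul_zero, mul_one] at rescale
  rw [← UnitAddCircle.intervalIntegral_preimage 0, circleAverage_def, ← rescale, zero_add]
  simp only [circleMap_two_pi_mul]

theorem integrable_comp_toCircle {f : ℂ → ℝ} (hf : Measurable f) (hfi : CircleIntegrable f 0 1) :
    Integrable fun x : UnitAddCircle => f (toCircle x) := by
  have rescale : IntervalIntegrable (fun θ => f (circleMap 0 1 (2 * π * θ))) volume 0 (0 + 1) := by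
    simpa [two_pi_pos.ne'] using IntervalIntegrable.comp_mul_left hfi (c := 2 * π)
  refine ((AddCircle.measurePreserving_mk 1 0).integrable_comp
    (hf.comp continuous_coe_toCircle.measurable).aestronglyMeasurable).1 ?_
  simp only [circleMap_two_pi_mul] at rescale
  exact (intervalIntegrable_iff_integrableOn_Ioc_of_le (by norm_num)).1 rescale

theorem integrable_log_norm_eval (p : ℂ[X]) :
    Integrable fun x : UnitAddCircle => log ‖p.eval (toCircle x : ℂ)‖ :=
  integrable_comp_toCircle (f := fun z => log ‖p.eval z‖)
    (measurable_log.comp p.continuous.norm.measurable)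
    (analyticOnNhd_id.aeval_polynomial p).meromorphicOn.circleIntegrable_log_norm

theorem ae_eval_toCircle_ne_zero {p : ℂ[X]} (hp : p ≠ 0) :
    ∀ᵐ x : UnitAddCircle, p.eval (toCircle x : ℂ) ≠ 0 := by
  have hfin : {x : UnitAddCircle | p.eval (toCircle x : ℂ) = 0}.Finite :=
    (p.rootSet_finite ℂ).preimage injective_coe_toCircle.injOn |>.subset fun x hx => by
      simpa [mem_rootSet, hp] using hx
  exact measure_eq_zero_iff_ae_notMem.1 (hfin.measure_zero _)

theorem integral_log_norm_eval_nonneg {p : ℂ[X]} (hp : p.Monic) :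
    0 ≤ ∫ x : UnitAddCircle, log ‖p.eval (toCircle x : ℂ)‖ := by
  rw [integral_comp_toCircle fun z => log ‖p.eval z‖, ← logMahlerMeasure_def,
    logMahlerMeasure_eq_log_MahlerMeasure]
  exact log_nonneg (one_le_mahlerMeasure_of_one_le_norm_leadingCoeff (by simp [hp.leadingCoeff]))

end Circle

section Poisson

/-- The Poisson kernel of the unit disc at the interior point `w`, as a function on `ℝ / ℤ`:
integrating against it reproduces the value at `w` of a harmonic function. -/
noncomputable def poisson (w : ℂ) (x : UnitAddCircle) : ℝ :=
  poissonKernel 0 w (toCircle x)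

theorem poisson_eq (w : ℂ) (x : UnitAddCircle) :
    poisson w x = (1 - ‖w‖ ^ 2) / ‖(toCircle x : ℂ) - w‖ ^ 2 := by
  simp [poisson, poissonKernel_def, norm_toCircle]

theorem poisson_zero (x : UnitAddCircle) : poisson 0 x = 1 := by
  simp [poisson_eq, norm_toCircle]

variable {w : ℂ}

theorem poisson_nonneg (hw : ‖w‖ < 1) (x : UnitAddCircle) : 0 ≤ poisson w x := by
  rw [poisson_eq]
  have : ‖w‖ ^ 2 ≤ 1 := pow_le_one₀ (norm_nonneg w) hw.le
  exact div_nonneg (by linarith) (by positivity)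

theorem poisson_le (hw : ‖w‖ < 1) (x : UnitAddCircle) : poisson w x ≤ 2 / (1 - ‖w‖) := by
  have : 0 < 1 - ‖w‖ := by linarith
  rw [poisson, poissonKernel_eq_re_herglotzRieszKernel]
  calc _ ≤ (1 + ‖w - 0‖) / (1 - ‖w - 0‖) :=
        re_herglotzRieszKernel_le (by simp [norm_toCircle]) (by simpa using hw)
    _ = (1 + ‖w‖) / (1 - ‖w‖) := by rw [sub_zero]
    _ ≤ 2 / (1 - ‖w‖) := by gcongr; linarith

theorem continuous_poisson (hw : ‖w‖ < 1) : Continuous (poisson w) := by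
  simp_rw [funext (poisson_eq w)]
  refine continuous_const.div ((continuous_coe_toCircle.sub continuous_const).norm.pow 2)
    fun x => ?_
  have : (toCircle x : ℂ) ≠ w := fun h => hw.ne (h ▸ norm_toCircle x)
  exact pow_ne_zero 2 (norm_ne_zero_iff.2 (sub_ne_zero.2 this))

theorem integrable_poisson_mul (hw : ‖w‖ < 1) {f : UnitAddCircle → ℝ} (hf : Integrable f) :
    Integrable fun x => poisson w x * f x := by
  refine hf.bdd_mul (c := 2 / (1 - ‖w‖)) (continuous_poisson hw).aestronglyMeasurable
    (ae_of_all _ fun x => ?_)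
  rw [norm_eq_abs, abs_of_nonneg (poisson_nonneg hw x)]
  exact poisson_le hw x

theorem integral_poisson_mul_of_harmonicOnNhd (hw : ‖w‖ < 1) {f : ℂ → ℝ}
    (hf : InnerProductSpace.HarmonicOnNhd f (Metric.closedBall 0 1)) :
    ∫ x, poisson w x * f (toCircle x) = f w :=
  (integral_comp_toCircle (poissonKernel 0 w • f)).trans
    (hf.circleAverage_poissonKernel_smul (by simpa using hw))

theorem integral_poisson (hw : ‖w‖ < 1) : ∫ x, poisson w x = 1 := by
  simpa using integral_poisson_mul_of_harmonicOnNhd hw (f := fun _ => 1)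
    fun _ _ => InnerProductSpace.harmonicAt_const _

theorem integral_poisson_mul_log_norm_sub {a : ℂ} (hw : ‖w‖ < 1) (ha : 1 ≤ ‖a‖) :
    ∫ x, poisson w x * log ‖(toCircle x : ℂ) - a‖ = log ‖w - a‖ := by
  rcases ha.eq_or_lt with ha | ha
  · rw [← circleAverage_re_herglotzRieszKernel_mul_log (c := 0) (R := 1) (ρ := a)
      (by simp [← ha]) (by simpa using hw), ← poissonKernel_eq_re_herglotzRieszKernel]
    exact integral_comp_toCircle (poissonKernel 0 w * (log ‖· - a‖))
  · refine integral_poisson_mul_of_harmonicOnNhd hw (f := fun ζ => log ‖ζ - a‖) fun ζ hζ => ?_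
    refine AnalyticAt.harmonicAt_log_norm (f := fun ζ => ζ - a) (by fun_prop) (sub_ne_zero.2 ?_)
    rintro rfl
    exact ha.not_ge (by simpa using hζ)

/-- For `‖a‖ < 1` the function on the left, unlike the one on the right, has no zero in the disc. -/
theorem norm_one_sub_conj_mul {ζ : ℂ} (hζ : ‖ζ‖ = 1) (a : ℂ) : ‖1 - conj a * ζ‖ = ‖ζ - a‖ := by
  have : ζ * conj ζ = 1 := by rw [Complex.mul_conj', hζ]; simp
  have : 1 - conj a * ζ = ζ * conj (ζ - a) := by
    rw [map_sub, mul_sub, this, mul_comm]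
  rw [this, norm_mul, hζ, one_mul, RCLike.norm_conj]

theorem integral_poisson_mul_log_norm_sub_of_norm_lt_one {a : ℂ} (hw : ‖w‖ < 1) (ha : ‖a‖ < 1) :
    ∫ x, poisson w x * log ‖(toCircle x : ℂ) - a‖ = log ‖1 - conj a * w‖ := by
  simp_rw [fun x => (norm_one_sub_conj_mul (norm_toCircle x) a).symm]
  refine integral_poisson_mul_of_harmonicOnNhd hw (f := fun ζ => log ‖1 - conj a * ζ‖)
    fun ζ hζ => ?_
  refine AnalyticAt.harmonicAt_log_norm (f := fun ζ => 1 - conj a * ζ) (by fun_prop) ?_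
  refine sub_ne_zero.2 fun h => ?_
  have : ‖conj a * ζ‖ < 1 := by
    rw [norm_mul, RCLike.norm_conj]
    exact mul_lt_one_of_nonneg_of_lt_one_left (norm_nonneg a) ha (by simpa using hζ)
  simp [← h] at this

end Poisson

section PolynomialGrowth

theorem one_add_mul_norm_sub_le {E : Type*} [NormedAddCommGroup E] [InnerProductSpace ℝ E]
    {u v : E} {r : ℝ} (huv : ‖v‖ ≤ ‖u‖) (hr₀ : 0 ≤ r) (hr₁ : r ≤ 1) :
    (1 + r) * ‖u - v‖ ≤ 2 * ‖u - r • v‖ := by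
  have hsq : ‖v‖ ^ 2 ≤ ‖u‖ ^ 2 := pow_le_pow_left₀ (norm_nonneg v) huv 2
  -- `2 (u - r v) = (1 + r) (u - v) + (1 - r) (u + v)`, and `⟪u - v, u + v⟫ = ‖u‖² - ‖v‖² ≥ 0`.
  have expand : (2 * ‖u - r • v‖) ^ 2 - ((1 + r) * ‖u - v‖) ^ 2
      = (1 - r) ^ 2 * ‖u + v‖ ^ 2 + 2 * (1 + r) * (1 - r) * (‖u‖ ^ 2 - ‖v‖ ^ 2) := by
    simp only [mul_pow, norm_sub_sq_real, norm_add_sq_real, inner_smul_right, norm_smul,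
      norm_eq_abs, sq_abs]
    ring
  refine abs_le_of_sq_le_sq' (sub_nonneg.1 (expand ▸ ?_)) (by positivity) |>.2
  have : 0 ≤ 1 - r := by linarith
  have : 0 ≤ ‖u‖ ^ 2 - ‖v‖ ^ 2 := by linarith
  positivity

theorem log_norm_sub_le {E : Type*} [NormedAddCommGroup E] [InnerProductSpace ℝ E]
    {u v : E} {r : ℝ} (hne : u ≠ v) (huv : ‖v‖ ≤ ‖u‖) (hr₀ : 0 ≤ r) (hr₁ : r ≤ 1) :
    log ‖u - v‖ ≤ (1 - r) + log ‖u - r • v‖ := by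
  have hpos : 0 < ‖u - v‖ := norm_pos_iff.2 (sub_ne_zero.2 hne)
  have hmul := one_add_mul_norm_sub_le huv hr₀ hr₁
  have hpos' : 0 < ‖u - r • v‖ := by
    have : 0 < (1 + r) * ‖u - v‖ := by positivity
    linarith
  have hlog : log (2 / (1 + r)) ≤ 1 - r := by
    refine (log_le_sub_one_of_pos (by positivity)).trans ?_
    rw [div_sub_one (by linarith), div_le_iff₀ (by linarith)]
    nlinarith
  calc log ‖u - v‖ ≤ log (2 / (1 + r) * ‖u - r • v‖) := by
        refine log_le_log hpos ?_
        rwa [div_mul_eq_mul_div, le_div_iff₀' (by linarith)]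
    _ = log (2 / (1 + r)) + log ‖u - r • v‖ := log_mul (by positivity) hpos'.ne'
    _ ≤ _ := by gcongr

variable {z : ℂ} {r : ℝ}

theorem norm_ofReal_mul_of_norm_eq_one (hz : ‖z‖ = 1) (hr₀ : 0 ≤ r) : ‖(r * z : ℂ)‖ = r := by
  simp [hz, abs_of_nonneg hr₀]

theorem log_norm_sub_le_integral_poisson {a : ℂ} (hz : ‖z‖ = 1) (ha : z ≠ a) (hr₀ : 0 ≤ r)
    (hr₁ : r < 1) :
    log ‖z - a‖ ≤ (1 - r) + ∫ x, poisson (r * z) x * log ‖(toCircle x : ℂ) - a‖ := by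
  have hw := (norm_ofReal_mul_of_norm_eq_one hz hr₀).trans_lt hr₁
  rcases le_or_gt 1 ‖a‖ with ha₁ | ha₁
  · rw [integral_poisson_mul_log_norm_sub hw ha₁, norm_sub_rev, norm_sub_rev _ a]
    simpa using log_norm_sub_le ha.symm (hz.trans_le ha₁) hr₀ hr₁.le
  · have hne : (1 : ℂ) ≠ conj a * z := by
      rw [← sub_ne_zero, ← norm_ne_zero_iff, norm_one_sub_conj_mul hz, norm_ne_zero_iff]
      exact sub_ne_zero.2 ha
    have hle : ‖conj a * z‖ ≤ ‖(1 : ℂ)‖ := by simpa [hz] using ha₁.le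
    rw [integral_poisson_mul_log_norm_sub_of_norm_lt_one hw ha₁, ← norm_one_sub_conj_mul hz,
      mul_left_comm]
    simpa using log_norm_sub_le hne hle hr₀ hr₁.le

theorem integral_poisson_mul_log_norm_eval_mul {w : ℂ} (hw : ‖w‖ < 1) {p q : ℂ[X]} (hp : p ≠ 0)
    (hq : q ≠ 0) :
    ∫ x, poisson w x * log ‖(p * q).eval (toCircle x : ℂ)‖
      = (∫ x, poisson w x * log ‖p.eval (toCircle x : ℂ)‖)
        + ∫ x, poisson w x * log ‖q.eval (toCircle x : ℂ)‖ := by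
  rw [← integral_add (integrable_poisson_mul hw (integrable_log_norm_eval p))
    (integrable_poisson_mul hw (integrable_log_norm_eval q))]
  refine integral_congr_ae ?_
  filter_upwards [ae_eval_toCircle_ne_zero hp, ae_eval_toCircle_ne_zero hq] with x hpx hqx
  rw [eval_mul, norm_mul, log_mul (norm_ne_zero_iff.2 hpx) (norm_ne_zero_iff.2 hqx), mul_add]

theorem log_norm_eval_le_integral_poisson (p : ℂ[X]) (hz : ‖z‖ = 1) (hpz : p.eval z ≠ 0)
    (hr₀ : 0 ≤ r) (hr₁ : r < 1) :
    log ‖p.eval z‖ ≤ p.natDegree * (1 - r)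
      + ∫ x, poisson (r * z) x * log ‖p.eval (toCircle x : ℂ)‖ := by
  have hw := (norm_ofReal_mul_of_norm_eq_one hz hr₀).trans_lt hr₁
  have hsplits : p.Splits := IsAlgClosed.splits p
  induction hsplits using Submonoid.closure_induction with
  | mem p hp =>
    rcases hp with ⟨a, rfl⟩ | ⟨a, rfl⟩
    · simp [integral_mul_const, integral_poisson hw]
    · have hne : z ≠ -a := fun h => hpz (by simp [h])
      simpa using log_norm_sub_le_integral_poisson hz hne hr₀ hr₁
  | one => simp
  | mul p q _ _ ihp ihq =>
    obtain ⟨hpz, hqz⟩ : p.eval z ≠ 0 ∧ q.eval z ≠ 0 := by simpa using hpz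
    have hp : p ≠ 0 := fun h => hpz (by simp [h])
    have hq : q ≠ 0 := fun h => hqz (by simp [h])
    rw [integral_poisson_mul_log_norm_eval_mul hw hp hq, natDegree_mul hp hq, eval_mul, norm_mul,
      log_mul (norm_ne_zero_iff.2 hpz) (norm_ne_zero_iff.2 hqz)]
    push_cast
    linarith [ihp hpz, ihq hqz]

end PolynomialGrowth

section SupBound

variable {p : ℂ[X]} {G : Set UnitAddCircle} {A κ : ℝ}

theorem integrable_norm_eval_sq (p : ℂ[X]) :
    Integrable fun x : UnitAddCircle => ‖p.eval (toCircle x : ℂ)‖ ^ 2 :=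
  integrable_of_continuous ((p.continuous.comp continuous_coe_toCircle).norm.pow 2)

theorem two_mul_log_le {t : ℝ} (ht : 0 < t) (a : ℝ) : 2 * log t ≤ a + exp (-a) * t ^ 2 - 1 := by
  have := add_one_le_exp (2 * log t - a)
  rw [sub_eq_neg_add, exp_add, mul_comm 2, exp_mul, exp_log ht, rpow_two] at this
  linarith

theorem setIntegral_poisson_mul_log_norm_eval_le (hp : p ≠ 0) (hA : 0 ≤ A)
    (hG : ∫ x in G, ‖p.eval (toCircle x : ℂ)‖ ^ 2 ≤ exp A) {w : ℂ} (hw : ‖w‖ < 1) :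
    ∫ x in G, poisson w x * log ‖p.eval (toCircle x : ℂ)‖ ≤ A / 2 + 1 / (1 - ‖w‖) := by
  have hP := integrable_of_continuous (continuous_poisson hw)
  have : 0 < 1 - ‖w‖ := by linarith
  have pointwise : ∀ᵐ x : UnitAddCircle, poisson w x * log ‖p.eval (toCircle x : ℂ)‖
      ≤ A / 2 * poisson w x
        + 1 / (1 - ‖w‖) * exp (-A) * ‖p.eval (toCircle x : ℂ)‖ ^ 2 := by
    filter_upwards [ae_eval_toCircle_ne_zero hp] with x hx
    calc poisson w x * log ‖p.eval (toCircle x : ℂ)‖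
        ≤ poisson w x * (A / 2 + exp (-A) * ‖p.eval (toCircle x : ℂ)‖ ^ 2 / 2) := by
          refine mul_le_mul_of_nonneg_left ?_ (poisson_nonneg hw x)
          linarith [two_mul_log_le (norm_pos_iff.2 hx) A]
      _ = A / 2 * poisson w x
          + poisson w x * (exp (-A) * ‖p.eval (toCircle x : ℂ)‖ ^ 2 / 2) := by ring
      _ ≤ A / 2 * poisson w x
          + 2 / (1 - ‖w‖) * (exp (-A) * ‖p.eval (toCircle x : ℂ)‖ ^ 2 / 2) := by
          gcongr
          exact poisson_le hw x
      _ = _ := by ring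
  calc ∫ x in G, poisson w x * log ‖p.eval (toCircle x : ℂ)‖
      ≤ ∫ x in G, (A / 2 * poisson w x
          + 1 / (1 - ‖w‖) * exp (-A) * ‖p.eval (toCircle x : ℂ)‖ ^ 2) :=
        setIntegral_mono_ae (integrable_poisson_mul hw (integrable_log_norm_eval p)).integrableOn
          ((hP.const_mul _).add ((integrable_norm_eval_sq p).const_mul _)).integrableOn pointwise
    _ = A / 2 * (∫ x in G, poisson w x)
          + 1 / (1 - ‖w‖) * exp (-A) * ∫ x in G, ‖p.eval (toCircle x : ℂ)‖ ^ 2 := by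
        rw [integral_add (hP.const_mul _).integrableOn
          ((integrable_norm_eval_sq p).const_mul _).integrableOn, integral_const_mul,
          integral_const_mul]
    _ ≤ A / 2 * 1 + 1 / (1 - ‖w‖) * exp (-A) * exp A := by
        gcongr
        exact (setIntegral_le_integral hP (ae_of_all _ (poisson_nonneg hw))).trans_eq
          (integral_poisson hw)
    _ = _ := by rw [mul_assoc, ← exp_add]; simp

theorem setIntegral_poisson_mul_le {w : ℂ} (hw : ‖w‖ < 1) {m S : ℝ} (hm : ∀ x, poisson w x ≤ m)
    (hS : 0 ≤ S) {U : UnitAddCircle → ℝ} (hU : Integrable U) (hUS : ∀ x, U x ≤ S) :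
    ∫ x in G, poisson w x * U x ≤ S * (m * volume.real G) := by
  refine (setIntegral_mono (g := fun _ => m * S) (integrable_poisson_mul hw hU).integrableOn
    (integrable_const _).integrableOn fun x => ?_).trans_eq ?_
  · exact (mul_le_mul_of_nonneg_left (hUS x) (poisson_nonneg hw x)).trans
      (mul_le_mul_of_nonneg_right (hm x) hS)
  · rw [setIntegral_const, smul_eq_mul]
    ring

theorem exists_forall_log_norm_eval_le (hp : p.Monic) : ∃ y : UnitAddCircle,
    p.eval (toCircle y : ℂ) ≠ 0 ∧ 0 ≤ log ‖p.eval (toCircle y : ℂ)‖ ∧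
      ∀ x : UnitAddCircle, log ‖p.eval (toCircle x : ℂ)‖ ≤ log ‖p.eval (toCircle y : ℂ)‖ := by
  obtain ⟨y, -, hy⟩ := isCompact_univ.exists_isMaxOn Set.univ_nonempty
    (p.continuous.comp continuous_coe_toCircle).norm.continuousOn
  replace hy (x : UnitAddCircle) : ‖p.eval (toCircle x : ℂ)‖ ≤ ‖p.eval (toCircle y : ℂ)‖ :=
    hy (Set.mem_univ x)
  have hae := ae_eval_toCircle_ne_zero hp.ne_zero
  obtain ⟨x₀, hx₀⟩ := hae.exists
  have hy₀ : p.eval (toCircle y : ℂ) ≠ 0 :=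
    norm_pos_iff.1 ((norm_pos_iff.2 hx₀).trans_le (hy x₀))
  have hS : 0 ≤ log ‖p.eval (toCircle y : ℂ)‖ := by
    refine (integral_log_norm_eval_nonneg hp).trans
      ((integral_mono_ae (g := fun _ => log ‖p.eval (toCircle y : ℂ)‖)
        (integrable_log_norm_eval p) (integrable_const _) ?_).trans_eq ?_)
    · filter_upwards [hae] with x hx using log_le_log (norm_pos_iff.2 hx) (hy x)
    · simp
  refine ⟨y, hy₀, hS, fun x => ?_⟩
  rcases eq_or_ne (p.eval (toCircle x : ℂ)) 0 with hx | hx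
  · simpa [hx] using hS
  · exact log_le_log (norm_pos_iff.2 hx) (hy x)

theorem log_norm_eval_le_of_forall_poisson_le (hp : p ≠ 0) {y : UnitAddCircle}
    (hy : p.eval (toCircle y : ℂ) ≠ 0) (hS : 0 ≤ log ‖p.eval (toCircle y : ℂ)‖)
    (hmax : ∀ x : UnitAddCircle, log ‖p.eval (toCircle x : ℂ)‖ ≤ log ‖p.eval (toCircle y : ℂ)‖)
    (hGm : MeasurableSet G) (hA : 0 ≤ A) (hG : ∫ x in G, ‖p.eval (toCircle x : ℂ)‖ ^ 2 ≤ exp A)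
    {r m : ℝ} (hr₀ : 0 ≤ r) (hr₁ : r < 1) (hm : ∀ x, poisson (r * toCircle y) x ≤ m) :
    log ‖p.eval (toCircle y : ℂ)‖ ≤ p.natDegree * (1 - r)
      + log ‖p.eval (toCircle y : ℂ)‖ * (m * volume.real Gᶜ) + (A / 2 + 1 / (1 - r)) := by
  have hwr := norm_ofReal_mul_of_norm_eq_one (norm_toCircle y) hr₀
  have hw := hwr.trans_lt hr₁
  have hmean := log_norm_eval_le_integral_poisson p (norm_toCircle y) hy hr₀ hr₁
  have hon := setIntegral_poisson_mul_log_norm_eval_le hp hA hG hw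
  have hoff := setIntegral_poisson_mul_le (G := Gᶜ) hw hm hS (integrable_log_norm_eval p) hmax
  rw [hwr] at hon
  rw [← integral_add_compl hGm (integrable_poisson_mul hw (integrable_log_norm_eval p))] at hmean
  linarith

/-- Apply the Poisson bound at a maximum of `‖p‖`, with a radius `r` whose distance to the circle is
comparable to the exceptional set, so that the maximum reappears on the right with a factor
smaller than one. -/
theorem log_norm_eval_le_of_setIntegral_le (hp : p.Monic) (hGm : MeasurableSet G)
    (hκ : volume.real Gᶜ ≤ κ) (hκ₁ : κ < 1) (hdeg : p.natDegree * volume.real Gᶜ ≤ A)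
    (hA : 1 ≤ A * volume.real Gᶜ) (hG : ∫ x in G, ‖p.eval (toCircle x : ℂ)‖ ^ 2 ≤ exp A)
    (x : UnitAddCircle) : log ‖p.eval (toCircle x : ℂ)‖ ≤ 10 * A / (1 - κ) := by
  obtain ⟨y, hy, hS, hmax⟩ := exists_forall_log_norm_eval_le hp
  refine (hmax x).trans ?_
  have hlam : 0 ≤ volume.real Gᶜ := measureReal_nonneg
  have hA₁ : 1 ≤ A := by nlinarith
  have hlam₀ : 0 < volume.real Gᶜ := by nlinarith
  have bound {r m : ℝ} := log_norm_eval_le_of_forall_poisson_le (r := r) (m := m) hp.ne_zero hy hS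
    hmax hGm (by linarith) hG
  generalize log ‖p.eval (toCircle y : ℂ)‖ = S at *
  generalize volume.real Gᶜ = lam at *
  rw [le_div_iff₀ (by linarith)]
  rcases le_or_gt lam (1 / 8) with hlam₈ | hlam₈
  · have hr₁ : 1 - 4 * lam < 1 := by linarith
    have hr₀ : 0 ≤ 1 - 4 * lam := by linarith
    have hwr := norm_ofReal_mul_of_norm_eq_one (norm_toCircle y) hr₀
    have h := bound (m := 2 / (4 * lam)) hr₀ hr₁ fun z =>
      (poisson_le (hwr.trans_lt hr₁) z).trans_eq (by rw [hwr, sub_sub_cancel])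
    have hcancel : 2 / (4 * lam) * lam = 1 / 2 := by field_simp; norm_num
    have hinv : 1 / (1 - (1 - 4 * lam)) ≤ A / 4 := by
      rw [div_le_iff₀ (by linarith)]
      linarith
    rw [hcancel] at h
    nlinarith
  · have h := bound (r := 0) (m := 1) le_rfl zero_lt_one fun z => by simp [poisson_zero]
    nlinarith [p.natDegree.cast_nonneg (α := ℝ)]

end SupBound

section Weight

variable {H : UnitAddCircle → ℝ≥0∞} {a : ℝ} {x : UnitAddCircle}

/-- The density of `expMeasure H`, taken real-valued so that it can multiply integrands. -/
noncomputable def weight (H : UnitAddCircle → ℝ≥0∞) (x : UnitAddCircle) : ℝ :=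
  (EReal.exp (-(H x : EReal))).toReal

/-- The set `{H ≤ a}`, for `a ≥ 0`; its complement is the set whose measure is `distrib H a`. -/
def sublevel (H : UnitAddCircle → ℝ≥0∞) (a : ℝ) : Set UnitAddCircle :=
  {x | H x ≤ ENNReal.ofReal a}

theorem exp_neg_le_one (H : UnitAddCircle → ℝ≥0∞) (x : UnitAddCircle) :
    EReal.exp (-(H x : EReal)) ≤ 1 := by
  rw [EReal.exp_le_one_iff, EReal.neg_le, neg_zero]
  exact EReal.coe_ennreal_nonneg _

theorem measurable_exp_neg (hH : Measurable H) : Measurable fun x => EReal.exp (-(H x : EReal)) :=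
  EReal.measurable_exp.comp (measurable_coe_ennreal_ereal.comp hH).neg

theorem weight_nonneg (H : UnitAddCircle → ℝ≥0∞) (x : UnitAddCircle) : 0 ≤ weight H x :=
  ENNReal.toReal_nonneg

theorem weight_le_one (H : UnitAddCircle → ℝ≥0∞) (x : UnitAddCircle) : weight H x ≤ 1 :=
  ENNReal.toReal_le_of_le_ofReal zero_le_one (by simpa using exp_neg_le_one H x)

theorem weight_of_ne_top (h : H x ≠ ∞) : weight H x = exp (-(H x).toReal) := by
  rw [weight, ← EReal.coe_ennreal_toReal h, ← EReal.coe_neg, EReal.exp_coe,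
    ENNReal.toReal_ofReal (exp_pos _).le]

theorem weight_of_mem_sublevel (hx : x ∈ sublevel H a) : weight H x = exp (-(H x).toReal) :=
  weight_of_ne_top (ne_top_of_le_ne_top ENNReal.ofReal_ne_top hx)

theorem weight_le_of_notMem_sublevel (ha : 0 ≤ a) (hx : x ∉ sublevel H a) :
    weight H x ≤ exp (-a) := by
  rcases eq_or_ne (H x) ∞ with htop | htop
  · simp [weight, htop, (exp_pos _).le]
  · rw [weight_of_ne_top htop, exp_le_exp, neg_le_neg_iff]
    exact ((ENNReal.ofReal_lt_iff_lt_toReal ha htop).1 (not_le.1 hx)).le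

theorem integral_expMeasure (hH : Measurable H) (f : UnitAddCircle → ℝ) :
    ∫ x, f x ∂(expMeasure H) = ∫ x, weight H x * f x :=
  integral_withDensity_eq_integral_toReal_smul (measurable_exp_neg hH)
    (ae_of_all _ fun x => (exp_neg_le_one H x).trans_lt ENNReal.one_lt_top) f

theorem integrable_weight_mul (hH : Measurable H) {f : UnitAddCircle → ℝ} (hf : Integrable f) :
    Integrable fun x => weight H x * f x := by
  refine hf.bdd_mul (c := 1) (measurable_exp_neg hH).ennreal_toReal.aestronglyMeasurable
    (ae_of_all _ fun x => ?_)
  rw [norm_eq_abs, abs_of_nonneg (weight_nonneg H x)]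
  exact weight_le_one H x

theorem measurableSet_sublevel (hH : Measurable H) (a : ℝ) : MeasurableSet (sublevel H a) :=
  measurableSet_le hH measurable_const

theorem volume_real_compl_sublevel (H : UnitAddCircle → ℝ≥0∞) (a : ℝ) :
    volume.real (sublevel H a)ᶜ = distrib H a := by
  simp only [sublevel, Set.compl_ofPred, not_le, distrib]

theorem volume_real_sublevel (hH : Measurable H) (a : ℝ) :
    volume.real (sublevel H a) = 1 - distrib H a := by
  rw [← volume_real_compl_sublevel, probReal_compl_eq_one_sub (measurableSet_sublevel hH a),
    sub_sub_cancel]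

theorem toReal_le_of_mem_sublevel (ha : 0 ≤ a) (hx : x ∈ sublevel H a) : (H x).toReal ≤ a :=
  ENNReal.toReal_le_of_le_ofReal ha hx

theorem distrib_nonneg (H : UnitAddCircle → ℝ≥0∞) (a : ℝ) : 0 ≤ distrib H a :=
  measureReal_nonneg

theorem distrib_le_one (H : UnitAddCircle → ℝ≥0∞) (a : ℝ) : distrib H a ≤ 1 :=
  measureReal_le_one

end Weight

section TruncIntegral

variable {H : UnitAddCircle → ℝ≥0∞} {a : ℝ}

/-- The integral of `H` over `{H ≤ a}`: the loss caused by the weight `e^{-H}` in Jensen's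
inequality. -/
noncomputable def truncIntegral (H : UnitAddCircle → ℝ≥0∞) (a : ℝ) : ℝ :=
  ∫ x in sublevel H a, (H x).toReal

theorem integrableOn_toReal (hH : Measurable H) (ha : 0 ≤ a) :
    IntegrableOn (fun x => (H x).toReal) (sublevel H a) := by
  refine Measure.integrableOn_of_bounded (M := a) (measure_ne_top _ _)
    hH.ennreal_toReal.aestronglyMeasurable ?_
  refine ae_restrict_of_forall_mem (measurableSet_sublevel hH a) fun x hx => ?_
  rw [norm_eq_abs, abs_of_nonneg ENNReal.toReal_nonneg]
  exact toReal_le_of_mem_sublevel ha hx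

theorem truncIntegral_nonneg (H : UnitAddCircle → ℝ≥0∞) (a : ℝ) : 0 ≤ truncIntegral H a :=
  integral_nonneg fun _ => ENNReal.toReal_nonneg

theorem truncIntegral_le (hH : Measurable H) (ha : 0 ≤ a) : truncIntegral H a ≤ a := by
  refine (setIntegral_mono_on (integrableOn_toReal hH ha) (integrable_const a).integrableOn
    (measurableSet_sublevel hH a) fun x => toReal_le_of_mem_sublevel ha).trans ?_
  rw [setIntegral_const, smul_eq_mul]
  exact mul_le_of_le_one_left ha measureReal_le_one

theorem truncIntegral_le_add_mul_distrib (hH : Measurable H) {b : ℝ} (ha : 0 ≤ a) (hab : a ≤ b) :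
    truncIntegral H b ≤ truncIntegral H a + b * distrib H a := by
  have hb : 0 ≤ b := ha.trans hab
  have hm := measurableSet_sublevel hH a
  have hint := integrableOn_toReal hH hb
  have hsub : sublevel H a ⊆ sublevel H b := fun x hx =>
    le_trans (b := ENNReal.ofReal a) hx (ENNReal.ofReal_le_ofReal hab)
  calc truncIntegral H b
      = truncIntegral H a + ∫ x in sublevel H b \ sublevel H a, (H x).toReal := by
        rw [truncIntegral, ← integral_inter_add_sdiff hm hint, Set.inter_eq_right.2 hsub]
        rfl
    _ ≤ truncIntegral H a + ∫ _ in sublevel H b \ sublevel H a, b := by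
        refine add_le_add le_rfl ?_
        exact setIntegral_mono_on (hint.mono_set Set.sdiff_subset) (integrable_const b).integrableOn
          ((measurableSet_sublevel hH b).diff hm) fun x hx => toReal_le_of_mem_sublevel hb hx.1
    _ ≤ truncIntegral H a + b * distrib H a := by
        rw [setIntegral_const, smul_eq_mul, mul_comm, ← volume_real_compl_sublevel]
        gcongr
        exacts [measure_ne_top _ _, Set.sdiff_subset_compl _ _]

end TruncIntegral

section LowerBound

variable {H : UnitAddCircle → ℝ≥0∞} {p : ℂ[X]} {A T κ : ℝ}

theorem setIntegral_exp_neg_mul_le_integral_expMeasure (hH : Measurable H) (A : ℝ)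
    {f : UnitAddCircle → ℝ} (hf₀ : ∀ x, 0 ≤ f x) (hf : Integrable f) :
    ∫ x in sublevel H A, exp (-(H x).toReal) * f x ≤ ∫ x, f x ∂(expMeasure H) := by
  rw [integral_expMeasure hH, setIntegral_congr_fun (measurableSet_sublevel hH A)
    fun x hx => congrArg (· * f x) (weight_of_mem_sublevel hx).symm]
  exact setIntegral_le_integral (integrable_weight_mul hH hf)
    (ae_of_all _ fun x => mul_nonneg (weight_nonneg H x) (hf₀ x))

theorem integrableOn_exp_neg_mul (hH : Measurable H) (A : ℝ) {f : UnitAddCircle → ℝ}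
    (hf : Integrable f) : IntegrableOn (fun x => exp (-(H x).toReal) * f x) (sublevel H A) :=
  (integrable_weight_mul hH hf).integrableOn.congr_fun
    (fun _ hx => congrArg (· * _) (weight_of_mem_sublevel hx)) (measurableSet_sublevel hH A)

theorem setIntegral_sublevel_le_exp_mul (hH : Measurable H) (hA : 0 ≤ A) {f : UnitAddCircle → ℝ}
    (hf₀ : ∀ x, 0 ≤ f x) (hf : Integrable f) :
    ∫ x in sublevel H A, f x ≤ exp A * ∫ x, f x ∂(expMeasure H) := by
  refine le_trans ?_ (mul_le_mul_of_nonneg_left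
    (setIntegral_exp_neg_mul_le_integral_expMeasure hH A hf₀ hf) (exp_pos A).le)
  rw [← integral_const_mul]
  refine setIntegral_mono_on hf.integrableOn ((integrableOn_exp_neg_mul hH A hf).const_mul _)
    (measurableSet_sublevel hH A) fun x hx => ?_
  rw [← mul_assoc, ← exp_add]
  exact le_mul_of_one_le_left (hf₀ x)
    (one_le_exp (by linarith [toReal_le_of_mem_sublevel hA hx]))

theorem setIntegral_sublevel_two_mul_log_norm_eval_le (hH : Measurable H) (hp : p ≠ 0)
    (hA : 0 ≤ A)
    (hpT : ∫ x, ‖p.eval (toCircle x : ℂ)‖ ^ 2 ∂(expMeasure H) ≤ exp (-T)) :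
    ∫ x in sublevel H A, 2 * log ‖p.eval (toCircle x : ℂ)‖
      ≤ truncIntegral H A - T * (1 - distrib H A) + 1 := by
  have hHi := integrableOn_toReal hH hA
  have hT : IntegrableOn (fun _ : UnitAddCircle => T) (sublevel H A) :=
    (integrable_const T).integrableOn
  have hsub : IntegrableOn (fun x => (H x).toReal - T) (sublevel H A) := hHi.sub hT
  have hE := (integrableOn_exp_neg_mul hH A (integrable_norm_eval_sq p)).const_mul (exp T)
  calc ∫ x in sublevel H A, 2 * log ‖p.eval (toCircle x : ℂ)‖
      ≤ ∫ x in sublevel H A, ((H x).toReal - T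
          + exp T * (exp (-(H x).toReal) * ‖p.eval (toCircle x : ℂ)‖ ^ 2)) := by
        refine setIntegral_mono_ae ((integrable_log_norm_eval p).const_mul 2).integrableOn
          (hsub.add hE) ?_
        filter_upwards [ae_eval_toCircle_ne_zero hp] with x hx
        have := two_mul_log_le (norm_pos_iff.2 hx) ((H x).toReal - T)
        rw [neg_sub, sub_eq_add_neg T, exp_add, mul_assoc] at this
        linarith
    _ = truncIntegral H A - T * (1 - distrib H A) + exp T *
          ∫ x in sublevel H A, exp (-(H x).toReal) * ‖p.eval (toCircle x : ℂ)‖ ^ 2 := by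
        rw [integral_add hsub hE, integral_sub hHi hT, setIntegral_const,
          integral_const_mul, volume_real_sublevel hH, smul_eq_mul, mul_comm T]
        rfl
    _ ≤ truncIntegral H A - T * (1 - distrib H A) + exp T * exp (-T) := by
        gcongr
        exact (setIntegral_exp_neg_mul_le_integral_expMeasure hH A (fun _ => by positivity)
          (integrable_norm_eval_sq p)).trans hpT
    _ = _ := by rw [← exp_add, add_neg_cancel, exp_zero]

theorem mul_one_sub_le_of_integral_expMeasure_le (hH : Measurable H) (hp : p.Monic)
    (hdeg : p.natDegree * distrib H A ≤ A) (hA : 1 ≤ A * distrib H A) (hκ : distrib H A ≤ κ)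
    (hκ₁ : κ < 1) (hT : 0 ≤ T)
    (hpT : ∫ x, ‖p.eval (toCircle x : ℂ)‖ ^ 2 ∂(expMeasure H) ≤ exp (-T)) :
    T * (1 - κ) ≤ 20 * (A * distrib H A) / (1 - κ) + truncIntegral H A + 1 := by
  have hA₀ : 0 ≤ A := (mul_nonneg (Nat.cast_nonneg _) (distrib_nonneg H A)).trans hdeg
  have hI : ∫ x in sublevel H A, ‖p.eval (toCircle x : ℂ)‖ ^ 2 ≤ exp A := by
    refine (setIntegral_sublevel_le_exp_mul hH hA₀ (fun _ => by positivity)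
      (integrable_norm_eval_sq p)).trans (mul_le_of_le_one_right (exp_pos A).le ?_)
    exact hpT.trans (exp_le_one_iff.2 (by linarith))
  rw [← volume_real_compl_sublevel] at hdeg hA hκ
  have hlog := (integrable_log_norm_eval p).const_mul 2
  have sup_bound := log_norm_eval_le_of_setIntegral_le hp (measurableSet_sublevel hH A) hκ hκ₁
    hdeg hA hI
  rw [volume_real_compl_sublevel] at hκ
  have jensen : 0 ≤ ∫ x : UnitAddCircle, 2 * log ‖p.eval (toCircle x : ℂ)‖ := by
    rw [integral_const_mul]
    exact mul_nonneg zero_le_two (integral_log_norm_eval_nonneg hp)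
  have off_sublevel : ∫ x in (sublevel H A)ᶜ, 2 * log ‖p.eval (toCircle x : ℂ)‖
      ≤ 20 * (A * distrib H A) / (1 - κ) := by
    refine (setIntegral_mono (g := fun _ => 2 * (10 * A / (1 - κ))) hlog.integrableOn
      (integrable_const _).integrableOn
      fun x => mul_le_mul_of_nonneg_left (sup_bound x) zero_le_two).trans_eq ?_
    rw [setIntegral_const, volume_real_compl_sublevel, smul_eq_mul]
    ring
  have on_sublevel := setIntegral_sublevel_two_mul_log_norm_eval_le hH hp.ne_zero hA₀ hpT
  rw [← integral_add_compl (measurableSet_sublevel hH A) hlog] at jensen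
  have : T * (1 - κ) ≤ T * (1 - distrib H A) := by gcongr
  linarith

theorem exists_monic_eval_eq {n : ℕ} (q : Fin n → ℂ) : ∃ p : ℂ[X], p.Monic ∧ p.natDegree = n ∧
    ∀ z : ℂ, ∑ j : Fin n, q j * z ^ (j : ℕ) + z ^ n = p.eval z := by
  have hdeg := degree_sum_fin_lt q
  refine ⟨X ^ n + ∑ j : Fin n, C (q j) * X ^ (j : ℕ), monic_X_pow_add hdeg, ?_, fun z => ?_⟩
  · refine natDegree_eq_of_degree_eq_some ?_
    rw [degree_add_eq_left_of_degree_lt] <;> rw [degree_X_pow]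
    exact hdeg
  · simp [eval_finsetSum, add_comm]

theorem exp_neg_le_predErr (hH : Measurable H) {n : ℕ} (hn : n * distrib H A ≤ A)
    (hA : 1 ≤ A * distrib H A) (hκ : distrib H A ≤ κ) (hκ₁ : κ < 1)
    (hT : 20 * (A * distrib H A) / (1 - κ) + truncIntegral H A + 1 < T * (1 - κ)) :
    exp (-T) ≤ predErr (expMeasure H) n := by
  have hκ₀ : 0 < 1 - κ := by linarith
  have hT₀ : 0 < T := by
    have := truncIntegral_nonneg H A
    have : 0 ≤ 20 * (A * distrib H A) / (1 - κ) := by positivity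
    exact pos_of_mul_pos_left (by linarith) hκ₀.le
  refine le_ciInf fun q => le_sqrt_of_sq_le ?_
  obtain ⟨p, hp, rfl, hpq⟩ := exists_monic_eval_eq q
  simp only [hpq]
  by_contra! hlt
  have hpT : ∫ x, ‖p.eval (toCircle x : ℂ)‖ ^ 2 ∂(expMeasure H) ≤ exp (-T) := by
    refine hlt.le.trans (pow_le_of_le_one (exp_pos _).le ?_ two_ne_zero)
    exact exp_le_one_iff.2 (by linarith)
  exact hT.not_ge (mul_one_sub_le_of_integral_expMeasure_le hH hp hn hA hκ hκ₁ hT₀.le hpT)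

end LowerBound

section Doubling

theorem dyadic_induction {P : ℝ → Prop} {a₀ : ℝ} (h₀ : 0 < a₀)
    (base : ∀ a, a₀ ≤ a → a ≤ 2 * a₀ → P a) (double : ∀ a, a₀ ≤ a → P a → P (2 * a)) {a : ℝ}
    (ha : a₀ ≤ a) : P a := by
  obtain ⟨k, hk⟩ := pow_unbounded_of_one_lt (a / a₀) one_lt_two
  rw [div_lt_iff₀ h₀] at hk
  induction k generalizing a with
  | zero => exact base a ha (by linarith)
  | succ k ih =>
    rcases le_total a (2 * a₀) with h | h
    · exact base a ha h
    · have := double (a / 2) (by linarith) (ih (by linarith) (by rw [pow_succ] at hk; linarith))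
      rwa [mul_div_cancel₀ a two_ne_zero] at this

theorem exists_pos_forall_eventually {P : ℝ → Prop} (h : ∀ᶠ a in atTop, P a) :
    ∃ a₀ > 0, ∀ a ≥ a₀, P a :=
  ((eventually_gt_atTop 0).and (eventually_forall_ge_atTop.2 h)).exists

variable {f : ℝ → ℝ} {p : ℝ}

theorem exists_mul_rpow_le_mul_self (hf : Antitone f) (hpos : ∀ a, 0 < f a) (hp : 0 < p)
    (hp₂ : p ≤ 2) (hfp : ∀ᶠ a in atTop, f a ≤ p * f (2 * a)) :
    ∃ C > 0, ∀ᶠ a in atTop, C * a ^ logb 2 (2 / p) ≤ a * f a := by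
  obtain ⟨a₀, h₀, hd⟩ := exists_pos_forall_eventually hfp
  have two_rpow : (2 : ℝ) ^ logb 2 (2 / p) = 2 / p :=
    rpow_logb two_pos (by norm_num) (by positivity)
  have hs : 0 ≤ logb 2 (2 / p) := logb_nonneg one_lt_two ((one_le_div hp).2 hp₂)
  generalize logb 2 (2 / p) = s at *
  have hpos₀ := hpos (2 * a₀)
  refine ⟨a₀ * f (2 * a₀) / (2 * a₀) ^ s, by positivity, (eventually_ge_atTop a₀).mono fun a ha =>
    dyadic_induction (P := fun a => a₀ * f (2 * a₀) / (2 * a₀) ^ s * a ^ s ≤ a * f a) h₀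
      (fun a h₁ h₂ => ?_) (fun a h₁ ih => ?_) ha⟩
  · rw [div_mul_eq_mul_div, div_le_iff₀ (by positivity)]
    have := h₀.trans_le h₁
    have := hpos a
    gcongr
    exact hf h₂
  · calc a₀ * f (2 * a₀) / (2 * a₀) ^ s * (2 * a) ^ s
        = 2 / p * (a₀ * f (2 * a₀) / (2 * a₀) ^ s * a ^ s) := by
          rw [mul_rpow two_pos.le (h₀.le.trans h₁), two_rpow]
          ring
      _ ≤ 2 / p * (a * (p * f (2 * a))) := by
          refine mul_le_mul_of_nonneg_left (ih.trans ?_) (by positivity)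
          exact mul_le_mul_of_nonneg_left (hd a h₁) (h₀.le.trans h₁)
      _ = 2 * a * f (2 * a) := by field_simp

theorem tendsto_mul_self_atTop (hf : Antitone f) (hpos : ∀ a, 0 < f a) (hp : 0 < p) (hp₂ : p < 2)
    (hfp : ∀ᶠ a in atTop, f a ≤ p * f (2 * a)) : Tendsto (fun a => a * f a) atTop atTop := by
  obtain ⟨C, hC, hle⟩ := exists_mul_rpow_le_mul_self hf hpos hp hp₂.le hfp
  have hs : 0 < logb 2 (2 / p) := logb_pos one_lt_two ((one_lt_div hp).2 hp₂)
  exact tendsto_atTop_mono' _ hle ((tendsto_rpow_atTop hs).const_mul_atTop hC)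

theorem exists_forall_of_eventually (hf : Antitone f) (hpos : ∀ a, 0 < f a) {P : ℝ → Prop}
    (hP : ∀ᶠ A in atTop, P A) : ∃ n₀ : ℕ, ∀ n ≥ n₀, ∀ A : ℝ, n * f A = A → P A := by
  obtain ⟨a, ha⟩ := eventually_atTop.1 hP
  obtain ⟨n₀, hn₀⟩ := exists_nat_ge (a / f a)
  refine ⟨n₀, fun n hn A hA => ha A ?_⟩
  by_contra! hlt
  have : a ≤ A := calc
    a ≤ n₀ * f a := (div_le_iff₀ (hpos a)).1 hn₀
    _ ≤ n * f A := mul_le_mul (Nat.cast_le.2 hn) (hf hlt.le) (hpos a).le n.cast_nonneg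
    _ = A := hA
  exact this.not_gt hlt

end Doubling

section Distrib

variable {H : UnitAddCircle → ℝ≥0∞} {p : ℝ}

theorem antitone_distrib (H : UnitAddCircle → ℝ≥0∞) : Antitone (distrib H) := fun _ _ hab =>
  measureReal_mono fun _ hx => (ENNReal.ofReal_le_ofReal hab).trans_lt hx

theorem distrib_pos (hH : ∫⁻ x, H x = ∞) (a : ℝ) : 0 < distrib H a := by
  refine measureReal_nonneg.lt_of_ne' fun h => ?_
  have : ∀ᵐ x, H x ≤ ENNReal.ofReal a := by
    simpa only [ae_iff, not_le] using (measureReal_eq_zero_iff (measure_ne_top _ _)).1 h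
  have := lintegral_mono_ae this
  simp [hH] at this

theorem tendsto_distrib_atTop (hH : Measurable H) :
    Tendsto (distrib H) atTop (𝓝 (volume.real {x | H x = ∞})) := by
  have iInter_eq : ⋂ a : ℝ, {x | ENNReal.ofReal a < H x} = {x | H x = ∞} := by
    ext x
    simp only [Set.mem_iInter, Set.mem_ofPred_eq]
    refine ⟨fun h => by_contra fun hx => ?_, fun h a => h ▸ ENNReal.ofReal_lt_top⟩
    exact (h (H x).toReal).ne (ENNReal.ofReal_toReal hx)
  have := tendsto_measure_iInter_atTop (μ := (volume : Measure UnitAddCircle))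
    (s := fun a : ℝ => {x | ENNReal.ofReal a < H x})
    (fun a => (measurableSet_lt measurable_const hH).nullMeasurableSet)
    (fun _ _ hab _ hx => (ENNReal.ofReal_le_ofReal hab).trans_lt hx) ⟨0, measure_ne_top _ _⟩
  rw [iInter_eq] at this
  exact (ENNReal.tendsto_toReal (measure_ne_top _ _)).comp this

theorem eventually_distrib_le_mul_distrib_two_mul (hH : ∫⁻ x, H x = ∞) (hp : 0 < p)
    (hlim : limsup (fun a => ENNReal.ofReal (distrib H a / distrib H (2 * a))) atTop
      < ENNReal.ofReal p) :
    ∀ᶠ a in atTop, distrib H a ≤ p * distrib H (2 * a) := by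
  filter_upwards [eventually_lt_of_limsup_lt hlim] with a ha
  rw [ENNReal.ofReal_lt_ofReal_iff hp, div_lt_iff₀ (distrib_pos hH _)] at ha
  exact ha.le

theorem exists_truncIntegral_le (hH : Measurable H) (hp : 0 < p) (hp₂ : p < 2)
    (hd : ∀ᶠ a in atTop, distrib H a ≤ p * distrib H (2 * a)) :
    ∃ D, ∀ᶠ a in atTop, truncIntegral H a ≤ D + 2 * p / (2 - p) * (a * distrib H a) := by
  obtain ⟨a₀, h₀, hd⟩ := exists_pos_forall_eventually hd
  have hC : 0 ≤ 2 * p / (2 - p) := div_nonneg (by linarith) (by linarith)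
  refine ⟨2 * a₀, (eventually_ge_atTop a₀).mono fun a ha => dyadic_induction
    (P := fun a => truncIntegral H a ≤ 2 * a₀ + 2 * p / (2 - p) * (a * distrib H a)) h₀
    (fun a h₁ h₂ => ?_) (fun a h₁ ih => ?_) ha⟩
  · have ha := h₀.le.trans h₁
    have := mul_nonneg hC (mul_nonneg ha (distrib_nonneg H a))
    linarith [truncIntegral_le hH ha]
  · have ha := h₀.le.trans h₁
    calc truncIntegral H (2 * a)
        ≤ truncIntegral H a + 2 * a * distrib H a :=
          truncIntegral_le_add_mul_distrib hH ha (by linarith)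
      _ ≤ 2 * a₀ + (2 * p / (2 - p) + 2) * (a * distrib H a) := by linarith
      _ ≤ 2 * a₀ + (2 * p / (2 - p) + 2) * (a * (p * distrib H (2 * a))) := by
          gcongr
          exact hd a h₁
      _ = 2 * a₀ + 2 * p / (2 - p) * (2 * a * distrib H (2 * a)) := by
          have : 2 - p ≠ 0 := by linarith
          field_simp
          ring

end Distrib

section Reflection

variable {ρ : Measure UnitAddCircle} {p : ℂ[X]}

theorem predErr_le_of_monic (ρ : Measure UnitAddCircle) (hp : p.Monic) :
    predErr ρ p.natDegree ≤ √(∫ x, ‖p.eval (toCircle x : ℂ)‖ ^ 2 ∂ρ) := by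
  unfold predErr
  refine (ciInf_le ⟨0, ?_⟩ fun j : Fin p.natDegree => p.coeff j).trans_eq ?_
  · rintro _ ⟨q, rfl⟩
    exact sqrt_nonneg _
  · simp only [eval_eq_sum_range, Finset.sum_range_succ, hp.coeff_natDegree, one_mul,
      Finset.sum_range]

theorem norm_eval_map_reflect {z : ℂ} (hz : ‖z‖ = 1) {n : ℕ} (hp : p.natDegree ≤ n) :
    ‖((p.reflect n).map (starRingEnd ℂ)).eval z‖ = ‖p.eval z‖ := by
  have hz₀ : z⁻¹ ≠ 0 := inv_ne_zero (norm_ne_zero_iff.1 (by simp [hz]))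
  have conj_eq : conj z = z⁻¹ := (Complex.inv_eq_conj hz).symm
  let := invertibleOfNonzero hz₀
  have := eval₂_reflect_mul_pow (starRingEnd ℂ) z⁻¹ n p hp
  rw [invOf_eq_inv, inv_inv, ← conj_eq, eval₂_at_apply] at this
  rw [eval_map, ← RCLike.norm_conj (p.eval z), ← this, norm_mul, norm_pow, RCLike.norm_conj, hz,
    one_pow, mul_one]

theorem predErr_le_div (ρ : Measure UnitAddCircle) {n : ℕ} (hn : p.natDegree ≤ n)
    (hp : p.coeff 0 ≠ 0) :
    predErr ρ n ≤ √(∫ x, ‖p.eval (toCircle x : ℂ)‖ ^ 2 ∂ρ) / ‖p.coeff 0‖ := by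
  have hc : (conj (p.coeff 0))⁻¹ ≠ 0 := by simpa using hp
  have hr_coeff : ((p.reflect n).map (starRingEnd ℂ)).coeff n = conj (p.coeff 0) := by
    simp [coeff_reflect, revAt_le]
  have hr_deg : ((p.reflect n).map (starRingEnd ℂ)).natDegree = n := by
    refine natDegree_eq_of_le_of_coeff_ne_zero (natDegree_map_le.trans ?_) (by simpa [hr_coeff])
    exact natDegree_reflect_le.trans (max_le le_rfl hn)
  have hmonic : (C (conj (p.coeff 0))⁻¹ * (p.reflect n).map (starRingEnd ℂ)).Monic := by
    refine monic_C_mul_of_mul_leadingCoeff_eq_one ?_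
    rw [leadingCoeff, hr_deg, hr_coeff, inv_mul_cancel₀ (by simpa using hp)]
  have h := predErr_le_of_monic ρ hmonic
  rw [natDegree_C_mul hc, hr_deg] at h
  simp only [eval_mul, eval_C, norm_mul, mul_pow, norm_eval_map_reflect (norm_toCircle _) hn,
    norm_inv, RCLike.norm_conj, integral_const_mul] at h
  rwa [sqrt_mul (by positivity), sqrt_sq (by positivity), inv_mul_eq_div] at h

theorem predErr_expMeasure_le_div {H : UnitAddCircle → ℝ≥0∞} (hH : Measurable H) {n : ℕ}
    (hn : p.natDegree ≤ n) (hp : p.coeff 0 ≠ 0) {M : ℝ} (hM : 0 ≤ M)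
    (hpM : ∀ x : UnitAddCircle, weight H x * ‖p.eval (toCircle x : ℂ)‖ ^ 2 ≤ M ^ 2) :
    predErr (expMeasure H) n ≤ M / ‖p.coeff 0‖ := by
  refine (predErr_le_div _ hn hp).trans ?_
  gcongr
  rw [sqrt_le_left hM, integral_expMeasure hH]
  refine (integral_mono (integrable_weight_mul hH (integrable_norm_eval_sq p))
    (integrable_const _) hpM).trans_eq ?_
  simp

end Reflection

section ArcFunction

theorem exists_polynomial_norm_eval_sub_le {f : ℂ → ℂ} {R M : ℝ} (hR : 1 < R)
    (hf : DiffContOnCl ℂ f (Metric.ball 0 R)) (hM : ∀ z, ‖z‖ = R → ‖f z‖ ≤ M) (n : ℕ) :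
    ∃ p : ℂ[X], p.natDegree ≤ n ∧ p.coeff 0 = f 0 ∧
      ∀ z : ℂ, ‖z‖ ≤ 1 → ‖p.eval z - f z‖ ≤ M * R⁻¹ ^ (n + 1) / (1 - R⁻¹) := by
  have hR₀ : 0 < R := by linarith
  set s := PowerSeries.mk fun k => (k.factorial : ℂ)⁻¹ * iteratedDeriv k f 0
  refine ⟨s.trunc (n + 1), Nat.lt_succ_iff.1 (s.natDegree_trunc_lt n),
    by simp [PowerSeries.coeff_trunc, s], fun z hz => ?_⟩
  have taylor := Complex.hasSum_taylorSeries_on_ball (c := 0) (z := z) hf.differentiableOn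
    (by simpa using hz.trans_lt hR)
  rw [eval, PowerSeries.eval₂_trunc_eq_sum_range]
  refine norm_sub_le_of_geometric_bound_of_hasSum (inv_lt_one_of_one_lt₀ hR) (fun k => ?_)
    (by simpa [s, mul_comm, mul_left_comm, mul_assoc] using taylor) (n + 1)
  have cauchy := Complex.norm_iteratedDeriv_le_of_forall_mem_sphere_norm_le k hR₀ hf
    fun w hw => hM w (mem_sphere_zero_iff_norm.1 hw)
  have : (0 : ℝ) < k.factorial := by positivity
  simp only [RingHom.id_apply, s, PowerSeries.coeff_mk, norm_mul, norm_inv, norm_pow,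
    Complex.norm_natCast]
  calc (k.factorial : ℝ)⁻¹ * ‖iteratedDeriv k f 0‖ * ‖z‖ ^ k
      ≤ (k.factorial : ℝ)⁻¹ * ‖iteratedDeriv k f 0‖ :=
        mul_le_of_le_one_right (by positivity) (pow_le_one₀ (norm_nonneg z) hz)
    _ ≤ (k.factorial : ℝ)⁻¹ * (k.factorial * M / R ^ k) := by gcongr
    _ = M * R⁻¹ ^ k := by
        rw [inv_pow]
        field_simp

/-- With `u = h / (1 - (1 - h) z)`, the function `(u - h / 2) + 3 (u² - h² / 2)`: it is bounded on
a disc of radius larger than `1` by a constant independent of `h`, its value at `0` is comparable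
to `h`, and its real part is nonpositive on the unit circle off an arc of half-length `h`
about `1`. -/
noncomputable def arcFun (h : ℝ) (z : ℂ) : ℂ :=
  (h / (1 - (1 - h) * z) - h / 2) + 3 * ((h / (1 - (1 - h) * z)) ^ 2 - h ^ 2 / 2)

variable {h : ℝ} {z : ℂ}

theorem half_le_norm_one_sub (h₀ : 0 ≤ h) (h₁ : h ≤ 1) (hz : ‖z‖ ≤ 1 + h / 2) :
    h / 2 ≤ ‖1 - (1 - h) * z‖ := by
  have hnorm : ‖(1 - h) * z‖ ≤ (1 - h) * (1 + h / 2) := by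
    rw [norm_mul, ← Complex.ofReal_one, ← Complex.ofReal_sub, Complex.norm_of_nonneg (by linarith)]
    exact mul_le_mul_of_nonneg_left hz (by linarith)
  have := norm_sub_norm_le 1 ((1 - h) * z)
  rw [norm_one] at this
  nlinarith

theorem norm_arcFun_le (h₀ : 0 < h) (h₁ : h ≤ 1 / 4) (hz : ‖z‖ ≤ 1 + h / 2) :
    ‖arcFun h z‖ ≤ 15 := by
  rw [arcFun]
  have hu : ‖h / (1 - (1 - h) * z)‖ ≤ 2 := by
    have := half_le_norm_one_sub h₀.le (by linarith) hz
    rw [norm_div, Complex.norm_of_nonneg h₀.le, div_le_iff₀ (by linarith)]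
    linarith
  have hh : ‖(h / 2 : ℂ)‖ = h / 2 := by simp [abs_of_pos h₀]
  have hh₂ : ‖(h ^ 2 / 2 : ℂ)‖ = h ^ 2 / 2 := by simp
  generalize (h : ℂ) / (1 - (1 - h) * z) = u at *
  calc ‖(u - h / 2) + 3 * (u ^ 2 - h ^ 2 / 2)‖
      ≤ ‖u - h / 2‖ + ‖3 * (u ^ 2 - h ^ 2 / 2)‖ := norm_add_le _ _
    _ = ‖u - h / 2‖ + 3 * ‖u ^ 2 - h ^ 2 / 2‖ := by simp
    _ ≤ (‖u‖ + ‖(h / 2 : ℂ)‖) + 3 * (‖u‖ ^ 2 + ‖(h ^ 2 / 2 : ℂ)‖) := by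
        rw [← norm_pow]
        gcongr <;> exact norm_sub_le _ _
    _ ≤ (2 + h / 2) + 3 * (2 ^ 2 + h ^ 2 / 2) := by
        rw [hh, hh₂]
        gcongr
    _ ≤ 15 := by nlinarith

theorem half_le_re_arcFun_zero (h : ℝ) : h / 2 ≤ (arcFun h 0).re := by
  have : arcFun h 0 = (h / 2 + 3 * (h ^ 2 / 2) : ℝ) := by
    simp only [arcFun]
    push_cast
    ring
  rw [this, Complex.ofReal_re]
  linarith [sq_nonneg h]

theorem re_arcFun (hz : ‖z‖ = 1) {D : ℝ} (hD : D = h ^ 2 + 2 * (1 - h) * (1 - z.re))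
    (hD₀ : 0 < D) :
    (arcFun h z).re = h ^ 2 / D *
      ((2 - h) / 2 + 3 * ((h * (2 - h)) ^ 2 / (2 * D) - (1 - h) ^ 2)) := by
  set v : ℂ := 1 - (1 - h) * z with hv
  have hre : v.re = 1 - (1 - h) * z.re := by simp [hv]
  have him : v.im = -((1 - h) * z.im) := by simp [hv]
  have hnormSq : Complex.normSq v = D := by
    have hz_sq : z.re * z.re + z.im * z.im = 1 := by
      rw [← Complex.normSq_apply, Complex.normSq_eq_norm_sq, hz, one_pow]
    rw [Complex.normSq_apply, hre, him, hD]
    linear_combination (1 - h) ^ 2 * hz_sq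
  have him_sq : v.im * v.im = D - v.re * v.re := by
    rw [← hnormSq, Complex.normSq_apply]
    ring
  have hdiv : (h / v : ℂ).re = h * v.re / D := by
    simp [Complex.div_re, hnormSq]
  have hdiv_im : (h / v : ℂ).im = -(h * v.im / D) := by
    simp [Complex.div_im, hnormSq]
  have hdiv_sq : ((h / v : ℂ) ^ 2).re = h ^ 2 * (2 * v.re ^ 2 - D) / D ^ 2 := by
    rw [sq (_ / v), Complex.mul_re, hdiv, hdiv_im]
    field_simp
    linear_combination -h ^ 2 * him_sq
  have hre_D : v.re = (h * (2 - h) + D) / 2 := by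
    rw [hre, hD]
    ring
  have hF : arcFun h z = (h / v - (h / 2 : ℝ)) + (3 : ℝ) * ((h / v) ^ 2 - (h ^ 2 / 2 : ℝ)) := by
    rw [arcFun]
    push_cast
    rfl
  rw [hF, Complex.add_re, Complex.re_ofReal_mul, Complex.sub_re, Complex.sub_re, hdiv, hdiv_sq,
    Complex.ofReal_re, Complex.ofReal_re, hre_D]
  field_simp
  ring

theorem exists_coe_eq_and_abs_eq_norm (x : UnitAddCircle) :
    ∃ t : ℝ, (t : UnitAddCircle) = x ∧ |t| = ‖x‖ := by
  obtain ⟨y, rfl⟩ := QuotientAddGroup.mk_surjective x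
  refine ⟨y - round y, ?_, UnitAddCircle.norm_eq.symm⟩
  rw [AddCircle.coe_sub, sub_eq_self]
  exact (AddCircle.coe_eq_zero_iff 1).2 ⟨round y, by simp⟩

theorem eight_mul_norm_sq_le (x : UnitAddCircle) : 8 * ‖x‖ ^ 2 ≤ 1 - (toCircle x : ℂ).re := by
  obtain ⟨t, rfl, ht⟩ := exists_coe_eq_and_abs_eq_norm x
  have hhalf : |t| ≤ 1 / 2 :=
    ht.trans_le (by simpa using AddCircle.norm_le_half_period 1 one_ne_zero)
  have := cos_le_one_sub_mul_cos_sq (x := 2 * π * t) (by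
    rw [abs_mul, abs_of_pos two_pi_pos]
    nlinarith [pi_pos])
  rw [← ht, sq_abs, AddCircle.toCircle_apply_mk, div_one, Circle.coe_exp,
    Complex.exp_ofReal_mul_I_re]
  field_simp at this
  linarith

theorem re_arcFun_toCircle_nonpos (h₀ : 0 < h) (h₁ : h ≤ 1 / 4) {x : UnitAddCircle}
    (hx : h ≤ ‖x‖) : (arcFun h (toCircle x)).re ≤ 0 := by
  have hre : 8 * h ^ 2 ≤ 1 - (toCircle x : ℂ).re :=
    le_trans (by gcongr) (eight_mul_norm_sq_le x)
  set D := h ^ 2 + 2 * (1 - h) * (1 - (toCircle x : ℂ).re) with hD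
  have hDh : 13 * h ^ 2 ≤ D := by nlinarith
  have hD₀ : 0 < D := by nlinarith
  rw [re_arcFun (norm_toCircle x) hD hD₀]
  have : (h * (2 - h)) ^ 2 / (2 * D) ≤ 2 / 13 := by
    rw [div_le_iff₀ (by positivity)]
    nlinarith
  refine mul_nonpos_of_nonneg_of_nonpos (by positivity) ?_
  nlinarith

theorem differentiableAt_arcFun (h₀ : 0 < h) (h₁ : h ≤ 1) (hz : ‖z‖ ≤ 1 + h / 2) :
    DifferentiableAt ℂ (arcFun h) z := by
  have : 1 - (1 - h) * z ≠ 0 :=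
    norm_pos_iff.1 (by linarith [half_le_norm_one_sub h₀.le h₁ hz])
  unfold arcFun
  fun_prop (disch := assumption)

end ArcFunction

section UpperBound

variable {H : UnitAddCircle → ℝ≥0∞} {A h : ℝ} {n : ℕ}

theorem exists_ball_subset_compl_sublevel (hr : 2 * h < longestArc H A) :
    ∃ β : UnitAddCircle, Metric.ball β h ⊆ (sublevel H A)ᶜ := by
  obtain ⟨l, ⟨-, -, α, hα⟩, hl⟩ :=
    exists_lt_of_lt_csSup (by exact ⟨0, le_rfl, zero_le_one, 0, by simp⟩) hr
  refine ⟨(α + h : ℝ), fun x hx => ?_⟩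
  obtain ⟨t, ht, ht_abs⟩ := exists_coe_eq_and_abs_eq_norm (x - (α + h : ℝ))
  have hth : |t| < h := by rwa [ht_abs, ← dist_eq_norm]
  have hx_eq : x = (α + h + t : ℝ) := by rw [AddCircle.coe_add _ _ t, ht, add_sub_cancel]
  rw [abs_lt] at hth
  simpa only [sublevel, Set.mem_compl_iff, Set.mem_ofPred_eq, not_le, hx_eq] using
    hα (α + h + t) ⟨by linarith, by linarith⟩

theorem exp_mul_inv_pow_div_le_one (h₀ : 0 < h) (h₁ : h ≤ 1 / 4) (hn : 9 ≤ n * h ^ 2) :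
    exp (15 * (n * h / 100)) * (1 + h / 2)⁻¹ ^ (n + 1) / (1 - (1 + h / 2)⁻¹) ≤ 1 := by
  have hinv : (1 + h / 2)⁻¹ ≤ 1 - 4 * h / 9 := by
    rw [inv_le_iff_one_le_mul₀ (by positivity)]
    nlinarith
  have hpow : (1 + h / 2)⁻¹ ^ (n + 1) ≤ exp (-(4 * n * h / 9)) := calc
    (1 + h / 2)⁻¹ ^ (n + 1) ≤ (1 + h / 2)⁻¹ ^ n :=
      pow_le_pow_of_le_one (by positivity) (hinv.trans (by linarith)) n.le_succ
    _ ≤ exp (-(4 * h / 9)) ^ n := by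
      gcongr
      exact hinv.trans (one_sub_le_exp_neg _)
    _ = exp (-(4 * n * h / 9)) := by
      rw [← exp_nat_mul]
      ring_nf
  have hexp : exp (-(29 / 100 * (n * h))) ≤ 4 * h / 9 := by
    have hnh : 9 / h ≤ n * h := by
      rw [div_le_iff₀ h₀]
      linarith
    have : 9 / (4 * h) ≤ exp (29 / 100 * (n * h)) := calc
      9 / (4 * h) = 1 / 4 * (9 / h) := by ring
      _ ≤ 29 / 100 * (n * h) + 1 := by linarith [show 0 < 9 / h by positivity]
      _ ≤ exp (29 / 100 * (n * h)) := add_one_le_exp _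
    rw [exp_neg, ← inv_div 9]
    exact inv_anti₀ (by positivity) this
  rw [div_le_one (by linarith)]
  calc exp (15 * (n * h / 100)) * (1 + h / 2)⁻¹ ^ (n + 1)
      ≤ exp (15 * (n * h / 100)) * exp (-(4 * n * h / 9)) := by gcongr
    _ ≤ exp (-(29 / 100 * (n * h))) := by
        rw [← exp_add, exp_le_exp]
        linarith [show 0 ≤ n * h by positivity]
    _ ≤ 1 - (1 + h / 2)⁻¹ := by linarith

theorem exists_polynomial_norm_eval_le_one_add_exp {c : ℂ} (hc : ‖c‖ = 1) (h₀ : 0 < h)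
    (h₁ : h ≤ 1 / 4) (hn : 9 ≤ n * h ^ 2) :
    ∃ p : ℂ[X], p.natDegree ≤ n ∧ exp (n * h ^ 2 / 200) ≤ ‖p.coeff 0‖ ∧
      ∀ z : ℂ, ‖z‖ = 1 → ‖p.eval z‖ ≤ 1 + exp (n * h / 100 * (arcFun h (c * z)).re) := by
  set f : ℂ → ℂ := fun z => Complex.exp ((n * h / 100 : ℝ) * arcFun h (c * z))
  have hf_norm (z : ℂ) : ‖f z‖ = exp (n * h / 100 * (arcFun h (c * z)).re) := by
    rw [Complex.norm_exp, Complex.re_ofReal_mul]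
  have hf_diff : DiffContOnCl ℂ f (Metric.ball 0 (1 + h / 2)) := by
    refine DifferentiableOn.diffContOnCl fun z hz => DifferentiableAt.differentiableWithinAt ?_
    rw [closure_ball _ (by positivity), mem_closedBall_zero_iff] at hz
    have := differentiableAt_arcFun (z := c * z) h₀ (by linarith) (by simpa [hc])
    exact ((this.comp z (by fun_prop)).const_mul _).cexp
  have hf_le (z : ℂ) (hz : ‖z‖ = 1 + h / 2) : ‖f z‖ ≤ exp (15 * (n * h / 100)) := by
    rw [hf_norm, mul_comm 15]
    gcongr
    exact (Complex.re_le_norm _).trans (norm_arcFun_le h₀ h₁ (by simp [hc, hz]))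
  obtain ⟨p, hdeg, hcoeff, hp⟩ :=
    exists_polynomial_norm_eval_sub_le (by linarith) hf_diff hf_le n
  refine ⟨p, hdeg, ?_, fun z hz => ?_⟩
  · rw [hcoeff, hf_norm, mul_zero, exp_le_exp]
    calc n * h ^ 2 / 200 = n * h / 100 * (h / 2) := by ring
      _ ≤ n * h / 100 * (arcFun h 0).re := by
        gcongr
        exact half_le_re_arcFun_zero h
  · rw [← hf_norm]
    have := (hp z hz.le).trans (exp_mul_inv_pow_div_le_one h₀ h₁ hn)
    linarith [norm_le_norm_add_norm_sub' (p.eval z) (f z)]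

theorem predErr_expMeasure_le_two_mul_exp (hH : Measurable H) (hA : 0 ≤ A) {β : UnitAddCircle}
    (hβ : Metric.ball β h ⊆ (sublevel H A)ᶜ) (h₀ : 0 < h) (h₁ : h ≤ 1 / 4)
    (hnA : n * h ≤ A) (hn : 9 ≤ n * h ^ 2) :
    predErr (expMeasure H) n ≤ 2 * exp (-(n * h ^ 2 / 200)) := by
  obtain ⟨p, hdeg, hcoeff, hp⟩ := exists_polynomial_norm_eval_le_one_add_exp
    (norm_toCircle (-β)) h₀ h₁ hn
  have hcoeff_ne : p.coeff 0 ≠ 0 := norm_pos_iff.1 ((exp_pos _).trans_le hcoeff)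
  have hp_eval (x : UnitAddCircle) :
      ‖p.eval (toCircle x : ℂ)‖ ≤ 1 + exp (n * h / 100 * (arcFun h (toCircle (x - β))).re) := by
    have := hp _ (norm_toCircle x)
    rwa [← Circle.coe_mul, ← AddCircle.toCircle_add, neg_add_eq_sub] at this
  refine (predErr_expMeasure_le_div hH hdeg hcoeff_ne zero_le_two fun x => ?_).trans ?_
  · rcases lt_or_ge ‖x - β‖ h with hx | hx
    · have hweight := weight_le_of_notMem_sublevel hA (hβ (mem_ball_iff_norm.2 hx))
      have hre : (arcFun h (toCircle (x - β))).re ≤ 15 :=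
        (Complex.re_le_norm _).trans (norm_arcFun_le h₀ h₁ (by rw [norm_toCircle]; linarith))
      have hnorm : ‖p.eval (toCircle x : ℂ)‖ ≤ 2 * exp (A / 2) := calc
        _ ≤ 1 + exp (n * h / 100 * 15) := (hp_eval x).trans (by gcongr)
        _ ≤ exp (A / 2) + exp (A / 2) := by
          gcongr
          · exact one_le_exp (by linarith)
          · linarith
        _ = 2 * exp (A / 2) := by ring
      calc _ ≤ exp (-A) * (2 * exp (A / 2)) ^ 2 := by gcongr
        _ = 2 ^ 2 := by
          rw [mul_pow, ← exp_nat_mul, mul_left_comm, ← exp_add]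
          simp only [Nat.cast_ofNat, mul_div_cancel₀ A two_ne_zero, neg_add_cancel, exp_zero,
            mul_one]
    · have hnorm : ‖p.eval (toCircle x : ℂ)‖ ≤ 2 := by
        have : exp (n * h / 100 * (arcFun h (toCircle (x - β))).re) ≤ 1 :=
          exp_le_one_iff.2 (mul_nonpos_of_nonneg_of_nonpos (by positivity)
            (re_arcFun_toCircle_nonpos h₀ h₁ hx))
        linarith [hp_eval x]
      calc _ ≤ 1 * ‖p.eval (toCircle x : ℂ)‖ ^ 2 := by
            gcongr
            exact weight_le_one H x
        _ ≤ 2 ^ 2 := by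
          rw [one_mul]
          gcongr
  · rw [exp_neg, ← div_eq_mul_inv]
    gcongr

theorem predErr_expMeasure_le_exp (hH : Measurable H) (hA : 0 ≤ A)
    (hh : 2 * h < longestArc H A) (h₀ : 0 < h) (h₁ : h ≤ 1 / 4) (hnA : n * h ≤ A)
    (hn : 400 ≤ n * h ^ 2) :
    predErr (expMeasure H) n ≤ exp (-(n * h ^ 2 / 400)) := by
  obtain ⟨β, hβ⟩ := exists_ball_subset_compl_sublevel hh
  have two_le : 2 ≤ exp (n * h ^ 2 / 400) := by
    linarith [add_one_le_exp (n * h ^ 2 / 400)]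
  calc predErr (expMeasure H) n
      ≤ 2 * exp (-(n * h ^ 2 / 200)) :=
        predErr_expMeasure_le_two_mul_exp hH hA hβ h₀ h₁ hnA (by linarith)
    _ ≤ exp (n * h ^ 2 / 400) * exp (-(n * h ^ 2 / 200)) := by gcongr
    _ = exp (-(n * h ^ 2 / 400)) := by
        rw [← exp_add]
        ring_nf

end UpperBound

section Asymptotics

variable {c κ : ℝ} {q : ℝ≥0∞}

theorem exists_real_btwn_of_lt_two (hq : q < 2) :
    ∃ p : ℝ, 0 < p ∧ p < 2 ∧ (q : ℝ≥0∞) < ENNReal.ofReal p := by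
  obtain ⟨p, -, hqp, hp₂⟩ := ENNReal.lt_iff_exists_real_btwn.1 hq
  have hp : 0 < p := ENNReal.ofReal_pos.1 (bot_le.trans_lt hqp)
  rw [ENNReal.ofReal_lt_iff_lt_toReal hp.le (by simp), ENNReal.toReal_ofNat] at hp₂
  exact ⟨p, hp, hp₂, hqp⟩

theorem exists_pos_eventually_exp_neg_le_predErr (hκ : κ < 1) (hq : q < 2) :
    ∃ L : ℝ, 0 < L ∧ ∀ H : UnitAddCircle → ℝ≥0∞, Measurable H → ∫⁻ x, H x = ∞ →
      volume.real {x | H x = ∞} ≤ κ →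
      limsup (fun a : ℝ => ENNReal.ofReal (distrib H a / distrib H (2 * a))) atTop ≤ q →
      ∀ᶠ A in atTop, ∀ n : ℕ, n * distrib H A = A →
        exp (-(L * (A * distrib H A))) ≤ predErr (expMeasure H) n := by
  obtain ⟨p, hp, hp₂, hqp⟩ := exists_real_btwn_of_lt_two hq
  obtain ⟨κ', hκκ', hκ'⟩ := exists_between hκ
  have hκ'_pos : 0 < 1 - κ' := by linarith
  have : 0 < 2 * p / (2 - p) := div_pos (by linarith) (by linarith)
  refine ⟨(20 / (1 - κ') + 2 * p / (2 - p) + 1) / (1 - κ'), by positivity,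
    fun H hH hI hinf hlim => ?_⟩
  have hdouble := eventually_distrib_le_mul_distrib_two_mul hI hp (hlim.trans_lt hqp)
  have htend := tendsto_mul_self_atTop (antitone_distrib H) (distrib_pos hI) hp hp₂ hdouble
  obtain ⟨D, hD⟩ := exists_truncIntegral_le hH hp hp₂ hdouble
  filter_upwards [hD, (tendsto_distrib_atTop hH).eventually_le_const (hinf.trans_lt hκκ'),
    htend.eventually_ge_atTop 1, htend.eventually_gt_atTop (D + 1)] with A hDA hκA h₁A hDA' n hn
  refine exp_neg_le_predErr hH hn.le h₁A hκA hκ' ?_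
  have : (20 / (1 - κ') + 2 * p / (2 - p) + 1) / (1 - κ') * (A * distrib H A) * (1 - κ') =
      20 * (A * distrib H A) / (1 - κ') + 2 * p / (2 - p) * (A * distrib H A)
        + A * distrib H A := by
    rw [mul_right_comm, div_mul_cancel₀ _ hκ'_pos.ne']
    ring
  linarith

theorem exists_pos_eventually_predErr_le_exp_neg (hc : 0 < c) (hq : q < 2) :
    ∃ l : ℝ, 0 < l ∧ ∀ H : UnitAddCircle → ℝ≥0∞, Measurable H → ∫⁻ x, H x = ∞ →
      (∀ᶠ a in atTop, c * distrib H a ≤ longestArc H a) →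
      limsup (fun a : ℝ => ENNReal.ofReal (distrib H a / distrib H (2 * a))) atTop ≤ q →
      ∀ᶠ A in atTop, ∀ n : ℕ, n * distrib H A = A →
        predErr (expMeasure H) n ≤ exp (-(l * (A * distrib H A))) := by
  obtain ⟨p, hp, hp₂, hqp⟩ := exists_real_btwn_of_lt_two hq
  obtain ⟨d, hd, hdc, hd₁⟩ : ∃ d, 0 < d ∧ d ≤ c ∧ d ≤ 1 :=
    ⟨min c 1, lt_min hc one_pos, min_le_left c 1, min_le_right c 1⟩
  refine ⟨d ^ 2 / 6400, by positivity, fun H hH hI hlong hlim => ?_⟩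
  have hdouble := eventually_distrib_le_mul_distrib_two_mul hI hp (hlim.trans_lt hqp)
  have htend := tendsto_mul_self_atTop (antitone_distrib H) (distrib_pos hI) hp hp₂ hdouble
  filter_upwards [hlong, htend.eventually_ge_atTop (6400 / d ^ 2), eventually_ge_atTop 0]
    with A hlongA hA hA₀ n hn
  have hpos : 0 < d * distrib H A := mul_pos hd (distrib_pos hI A)
  have hle_one : d * distrib H A ≤ 1 := mul_le_one₀ hd₁ (distrib_nonneg H A) (distrib_le_one H A)
  have hlong_d : d * distrib H A ≤ longestArc H A :=
    (mul_le_mul_of_nonneg_right hdc (distrib_nonneg H A)).trans hlongA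
  have hsq : n * (d * distrib H A / 4) ^ 2 = d ^ 2 / 16 * (A * distrib H A) := by
    linear_combination d ^ 2 / 16 * distrib H A * hn
  have hnA : n * (d * distrib H A / 4) = d / 4 * A := by
    linear_combination d / 4 * hn
  rw [div_le_iff₀' (by positivity)] at hA
  refine (predErr_expMeasure_le_exp hH hA₀ (h := d * distrib H A / 4) (by linarith)
    (by positivity) (by linarith) (by nlinarith) (by linarith)).trans_eq ?_
  rw [hsq]
  ring_nf

theorem inv_mul_le_abs_log_and_abs_log_le_mul {L l t e : ℝ} (hL : 0 < L) (hl : 0 < l) (ht : 0 ≤ t)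
    (hLe : exp (-(L * t)) ≤ e) (hle : e ≤ exp (-(l * t))) :
    (L + l⁻¹)⁻¹ * t ≤ |log e| ∧ |log e| ≤ (L + l⁻¹) * t := by
  have he : 0 < e := (exp_pos _).trans_le hLe
  have log_ge : -(L * t) ≤ log e := (le_log_iff_exp_le he).2 hLe
  have log_le : log e ≤ -(l * t) := (log_le_iff_le_exp he).2 hle
  have hlt : 0 ≤ l * t := by positivity
  rw [abs_of_nonpos (by linarith)]
  constructor
  · calc (L + l⁻¹)⁻¹ * t ≤ l * t := by
          gcongr
          exact inv_le_of_inv_le₀ hl (le_add_of_nonneg_left hL.le)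
      _ ≤ -log e := le_neg_of_le_neg log_le
  · calc -log e ≤ L * t := neg_le.1 log_ge
      _ ≤ (L + l⁻¹) * t := by
          gcongr
          exact le_add_of_nonneg_right (inv_pos.2 hl).le

end Asymptotics

end SzegoRate

theorem mainTheorem5_general (c κ : ℝ) (q : ℝ≥0∞) (hc : 0 < c) (hκ : κ < 1) (hq : q < 2) :
    ∃ K : ℝ, 0 < K ∧
      ∀ H : UnitAddCircle → ℝ≥0∞,
        Measurable H →
        ∫⁻ x, H x = ∞ →
        volume.real {x : UnitAddCircle | H x = ∞} ≤ κ →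
        (∀ᶠ a : ℝ in atTop, c * SzegoRate.distrib H a ≤ SzegoRate.longestArc H a) →
        limsup (fun a : ℝ => ENNReal.ofReal (SzegoRate.distrib H a / SzegoRate.distrib H (2 * a)))
          atTop ≤ q →
        ∃ n₀ : ℕ, ∀ n : ℕ, n₀ ≤ n → ∀ A : ℝ, n * SzegoRate.distrib H A = A →
          K⁻¹ * (A * SzegoRate.distrib H A)
              ≤ |Real.log (SzegoRate.predErr (SzegoRate.expMeasure H) n)| ∧
            |Real.log (SzegoRate.predErr (SzegoRate.expMeasure H) n)|
              ≤ K * (A * SzegoRate.distrib H A) := by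
  obtain ⟨L, hL, lower⟩ := SzegoRate.exists_pos_eventually_exp_neg_le_predErr hκ hq
  obtain ⟨l, hl, upper⟩ := SzegoRate.exists_pos_eventually_predErr_le_exp_neg hc hq
  refine ⟨L + l⁻¹, by positivity, fun H hH hI hinf hlong hlim => ?_⟩
  obtain ⟨n₀, hn₀⟩ := SzegoRate.exists_forall_of_eventually (SzegoRate.antitone_distrib H)
    (SzegoRate.distrib_pos hI)
    ((lower H hH hI hinf hlim).and ((upper H hH hI hlong hlim).and (eventually_ge_atTop 0)))
  refine ⟨n₀, fun n hn A hA => ?_⟩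
  obtain ⟨hlower, hupper, hA₀⟩ := hn₀ n hn A hA
  exact SzegoRate.inv_mul_le_abs_log_and_abs_log_le_mul hL hl
    (mul_nonneg hA₀ (SzegoRate.distrib_nonneg H A)) (hlower n hA) (hupper n hA)

theorem mainTheorem5 (c κ : ℝ) (q : ℝ≥0∞) (hc : 0 < c) (hκ : κ < 1) (hq : q < 2) :
    ∃ K : ℝ, 0 < K ∧
      ∀ H : UnitAddCircle → ℝ≥0∞,
        LowerSemicontinuous H →
        ∫⁻ x, H x = ∞ →
        volume.real {x : UnitAddCircle | H x = ∞} ≤ κ →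
        (∀ᶠ a : ℝ in atTop, c * SzegoRate.distrib H a ≤ SzegoRate.longestArc H a) →
        limsup (fun a : ℝ => ENNReal.ofReal (SzegoRate.distrib H a / SzegoRate.distrib H (2 * a)))
          atTop ≤ q →
        ∃ n₀ : ℕ, ∀ n : ℕ, n₀ ≤ n → ∀ A : ℝ, n * SzegoRate.distrib H A = A →
          K⁻¹ * (A * SzegoRate.distrib H A)
              ≤ |Real.log (SzegoRate.predErr (SzegoRate.expMeasure H) n)| ∧
            |Real.log (SzegoRate.predErr (SzegoRate.expMeasure H) n)|
              ≤ K * (A * SzegoRate.distrib H A) := by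
  obtain ⟨K, hK, h⟩ := mainTheorem5_general c κ q hc hκ hq
  exact ⟨K, hK, fun H hH => h H hH.measurable⟩
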